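/- For $p<0$ and a compact set $K\subset\mathbb R^2$ let $$V_p(K)=\max_{\mu}\int_K\int_K|x-y|^{-p}\,d\mu(x)\,d\mu(y),\qquad \operatorname{cap}_p(K)=V_p(K)^{-1/p},$$ where the maximum is over all Borel probability measures $\mu$ on $K$ (this is the Riesz $p$-capacity for negative exponent). A regular three-point set is the set of vertices of a nondegenerate equilateral triangle. The equation $$2\sqrt{\pi}\,\Gamma(1-q/2)=3\,\Gamma((1-q)/2)$$ has exactly one solution $q=q_*$ in $(-\infty,0)$, and $q_*\simeq-0.856$ (that is, $|q_*+0.856|<0.0005$). If $$-2<q<q_*\qquad\text{and}\qquad -\infty<p<\frac{q\,\log(4/3)}{\log\dfrac{2\sqrt{\pi}\,\Gamma(1-q/2)}{3\,\Gamma((1-q)/2)}},$$ then, for every closed disk $D\subset\mathbb R^2$ of positive radius and every regular three-point set $S\subset\mathbb R^2$, $$\frac{\operatorname{cap}_q(D)}{\operatorname{cap}_p(D)}<\frac{\operatorname{cap}_q(S)}{\operatorname{cap}_p(S)}.$$ In particular, for such $p$ and $q$ a disk does not maximize $\operatorname{cap}_q(K)/\operatorname{cap}_p(K)$ among the compact sets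 $K\subset\mathbb R^2$ with more than one point. -/

import Mathlib

open MeasureTheory
open scoped ENNReal

noncomputable section

namespace RieszCapacity

/-- Probability measures carried by the set `K` (Borel, when `E` carries its Borel σ-algebra). -/
def probOn {E : Type*} [MeasurableSpace E] (K : Set E) : Set (Measure E) :=
  {μ | IsProbabilityMeasure μ ∧ μ Kᶜ = 0}

/-- The Riesz energy `∬ |x - y|^(-p) dμ dμ` of a measure, with values in `[0, ∞]`.
For `p > 0` the kernel is `∞` on the diagonal, for `p < 0` it vanishes there. -/
def rieszEnergyOf {E : Type*} [MeasurableSpace E] [PseudoEMetricSpace E]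
    (p : ℝ) (μ : Measure E) : ℝ≥0∞ :=
  ∫⁻ x, ∫⁻ y, edist x y ^ (-p) ∂μ ∂μ

/-- The Riesz `p`-energy of a set, `p ≠ 0`: the infimum of the energies of probability measures
on `K` if `p > 0`, their supremum if `p < 0`. -/
def rieszEnergy {E : Type*} [MeasurableSpace E] [PseudoEMetricSpace E]
    (p : ℝ) (K : Set E) : ℝ≥0∞ :=
  if 0 < p then ⨅ μ ∈ probOn K, rieszEnergyOf p μ else ⨆ μ ∈ probOn K, rieszEnergyOf p μ

/-- The logarithmic energy `∬ log (1 / |x - y|) dμ dμ` of a measure, as the difference of the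
integrals of the positive and the negative part of the kernel (the latter integral is finite when
`μ` is a probability measure on a bounded set). -/
def logEnergyOf {E : Type*} [MeasurableSpace E] [PseudoEMetricSpace E]
    (μ : Measure E) : EReal :=
  ((∫⁻ x, ∫⁻ y, (ENNReal.log (edist x y)⁻¹).toENNReal ∂μ ∂μ : ℝ≥0∞) : EReal) -
    ((∫⁻ x, ∫⁻ y, (ENNReal.log (edist x y)).toENNReal ∂μ ∂μ : ℝ≥0∞) : EReal)

/-- The logarithmic energy of a set. -/
def logEnergy {E : Type*} [MeasurableSpace E] [PseudoEMetricSpace E] (K : Set E) : EReal :=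
  ⨅ μ ∈ probOn K, logEnergyOf μ

/-- The Riesz `p`-capacity of a set: `V_p(K)^(-1/p)` for `p ≠ 0`, and the logarithmic capacity
`exp (-V_log(K))` for `p = 0`. -/
def cap {E : Type*} [MeasurableSpace E] [PseudoEMetricSpace E] (p : ℝ) (K : Set E) : ℝ≥0∞ :=
  if p = 0 then EReal.exp (-logEnergy K) else rieszEnergy p K ^ (-1 / p)

/-- The capacity ratio `cap_q(K) / cap_p(K)`. -/
def capRatio {E : Type*} [MeasurableSpace E] [PseudoEMetricSpace E]
    (q p : ℝ) (K : Set E) : ℝ≥0∞ :=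
  cap q K / cap p K

/-- A regular three-point set: the vertices of a (nondegenerate) equilateral triangle. -/
def IsRegularThreePointSet {E : Type*} [NormedAddCommGroup E] [NormedSpace ℝ E]
    (S : Set E) : Prop :=
  ∃ T : Affine.Triangle ℝ E, T.Equilateral ∧ S = Set.range T.points

end RieszCapacity

end

/-! Put `b = -q` and `a = -p`. The disk's ratio is bounded above by an exact value in the numerator
and a crude competitor in the denominator, while the triangle's ratio is computed exactly.

For `0 < b < 2` the energy on the unit disk is largest for the uniform measure σ on the circle
(`mutualEnergy_self_le`). Two facts give this. First, `‖x - y‖ ^ b` is conditionally negative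
definite, being a superposition of `1 - cos ⟪x - y, ξ⟫`; hence I(μ) + I(σ) ≤ 2 I(μ, σ)
(`mutualEnergy_add_le`). Second, the potential of σ is at most its constant value `circleMean b` on
the circle, by a maximum principle (`integral_norm_sub_circle_le`). So I(μ) ≤ I(σ) = `circleMean b`,
a Wallis integral expressible through Γ. For the exponent `a`, half masses at the ends of a diameter
give energy (2r)^a / 2, which bounds the disk's energy from below. A regular three-point set of side
s has energy (2/3) s^b, attained at equal weights.

With R = `gammaQuotient b`, the identity `circleMean_mul_gammaQuotient` bounds the disk's ratio by
(2/3)^(1/b) R^(-1/b) 2^(1/a); the triangle's is (2/3)^(1/b - 1/a). The required inequality becomes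
(4/3)^(1/a) < R^(1/b), which is the hypothesis on p.

The threshold q_* is where R = 1. It is unique because R is a constant over ∫|sin|^b and so strictly
increasing, and it is located by two-sided bounds for Γ(x + 1/2)/Γ(x). -/

noncomputable section

namespace RieszCapacity

/-! ### Wallis integrals and the monotonicity of the gamma quotient -/

open Real in
/-- The Wallis-type integral of a real power of the sine over a full period. -/
theorem integral_abs_sin_rpow {b : ℝ} (hb : 0 < b) :
    ∫ θ in (-π)..π, |sin θ| ^ b = 2 * √π * Gamma ((b + 1) / 2) / Gamma (b / 2 + 1) := by
  have hG : ∀ q : ℝ, -1 < q →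
      ∫ x in Set.Ioi (0 : ℝ), x ^ q * exp (-x ^ 2) = 1 / 2 * Gamma ((q + 1) / 2) := by
    intro q hq
    have h := integral_rpow_mul_exp_neg_rpow (p := 2) (q := q) two_pos hq
    simpa only [rpow_two] using h
  -- The integral of |y|^b against the planar Gaussian is evaluated twice: as a product here, and in
  -- polar coordinates below, where the angular factor is the integral sought.
  have h1 : ∫ p : ℝ × ℝ, exp (-p.1 ^ 2) * (|p.2| ^ b * exp (-p.2 ^ 2)) =
      √π * Gamma ((b + 1) / 2) := by
    rw [Measure.volume_eq_prod,
      integral_prod_mul (fun x : ℝ => exp (-x ^ 2)) (fun y : ℝ => |y| ^ b * exp (-y ^ 2))]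
    have h2 : ∫ x : ℝ, exp (-x ^ 2) = √π := by simpa using integral_gaussian 1
    have h3 : ∫ y : ℝ, |y| ^ b * exp (-y ^ 2) = Gamma ((b + 1) / 2) := by
      have h := integral_comp_abs (f := fun y : ℝ => y ^ b * exp (-y ^ 2))
      simp only [sq_abs] at h
      rw [h, hG b (by linarith)]
      ring
    rw [h2, h3]
  rw [← integral_comp_polarCoord_symm] at h1
  have h4 : ∫ p in polarCoord.target, p.1 • (exp (-(polarCoord.symm p).1 ^ 2) *
      (|(polarCoord.symm p).2| ^ b * exp (-(polarCoord.symm p).2 ^ 2))) =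
      ∫ p in Set.Ioi (0 : ℝ) ×ˢ Set.Ioo (-π) π,
        (p.1 ^ (b + 1) * exp (-p.1 ^ 2)) * |sin p.2| ^ b := by
    rw [polarCoord_target]
    refine setIntegral_congr_fun (measurableSet_Ioi.prod measurableSet_Ioo) fun p hp => ?_
    have hp0 : 0 < p.1 := hp.1
    have he : exp (-p.1 ^ 2) = exp (-(p.1 * cos p.2) ^ 2) * exp (-(p.1 * sin p.2) ^ 2) := by
      rw [← exp_add]
      congr 1
      linear_combination (-p.1 ^ 2) * (sin_sq_add_cos_sq p.2).symm
    simp only [polarCoord_symm_apply, smul_eq_mul]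
    rw [he, abs_mul, abs_of_pos hp0, mul_rpow hp0.le (abs_nonneg _), rpow_add hp0, rpow_one]
    ring
  rw [h4, Measure.volume_eq_prod,
    setIntegral_prod_mul (fun r : ℝ => r ^ (b + 1) * exp (-r ^ 2)) (fun θ : ℝ => |sin θ| ^ b),
    hG (b + 1) (by linarith), ← integral_Ioc_eq_integral_Ioo,
    ← intervalIntegral.integral_of_le (by linarith [pi_pos]),
    show (b + 1 + 1) / 2 = b / 2 + 1 by ring] at h1
  have hpos : 0 < Gamma (b / 2 + 1) := Gamma_pos_of_pos (by positivity)
  rw [eq_div_iff hpos.ne']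
  linarith

/-- The mean of the `b`-th power of the distance from a point of the unit circle to the points
of the circle. -/
def circleMean (b : ℝ) : ℝ :=
  (2 * Real.pi)⁻¹ * ∫ θ in (-Real.pi)..Real.pi, |2 * Real.sin (θ / 2)| ^ b

open Real in
theorem circleMean_eq {b : ℝ} (hb : 0 < b) :
    circleMean b = 2 ^ b * (Gamma ((b + 1) / 2) / (√π * Gamma (b / 2 + 1))) := by
  have hc : Continuous fun θ : ℝ => |sin θ| ^ b :=
    continuous_sin.abs.rpow_const fun _ => Or.inr hb.le
  have hper : Function.Periodic (fun θ : ℝ => |sin θ| ^ b) π := fun θ => by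
    simp [sin_add_pi]
  have h1 : ∫ θ in (-π)..π, |2 * sin (θ / 2)| ^ b =
      2 ^ b * ∫ θ in (-π)..π, |sin (θ / 2)| ^ b := by
    rw [← intervalIntegral.integral_const_mul]
    refine intervalIntegral.integral_congr fun θ _ => ?_
    simp only [abs_mul, abs_two]
    rw [mul_rpow two_pos.le (abs_nonneg _)]
  have h2 : ∫ θ in (-π)..π, |sin (θ / 2)| ^ b = 2 * ∫ θ in (-π / 2)..(π / 2), |sin θ| ^ b := by
    rw [intervalIntegral.integral_comp_div (fun θ => |sin θ| ^ b) two_ne_zero, smul_eq_mul]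
  -- Since |sin| has period π, either half of [-π, π] may be shifted to [-π/2, π/2].
  have h3 : ∫ θ in (-π)..π, |sin θ| ^ b = 2 * ∫ θ in (-π / 2)..(π / 2), |sin θ| ^ b := by
    rw [← intervalIntegral.integral_add_adjacent_intervals (hc.intervalIntegrable (-π) 0)
      (hc.intervalIntegrable 0 π)]
    have e1 := hper.intervalIntegral_add_eq (-π) (-π / 2)
    have e2 := hper.intervalIntegral_add_eq 0 (-π / 2)
    rw [show -π + π = 0 by ring, show -π / 2 + π = π / 2 by ring] at e1
    rw [show 0 + π = π by ring, show -π / 2 + π = π / 2 by ring] at e2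
    rw [e1, e2]
    ring
  have hG : 0 < Gamma (b / 2 + 1) := Gamma_pos_of_pos (by positivity)
  have hs : √π * √π = π := mul_self_sqrt pi_pos.le
  rw [circleMean, h1, h2, ← h3, integral_abs_sin_rpow hb]
  have hs0 : 0 < √π := sqrt_pos.2 pi_pos
  have : (2 * π)⁻¹ = (2 * (√π * √π))⁻¹ := by rw [hs]
  rw [this]
  field_simp

theorem circleMean_pos {b : ℝ} (hb : 0 < b) : 0 < circleMean b := by
  rw [circleMean_eq hb]
  have h1 : 0 < Real.Gamma ((b + 1) / 2) := Real.Gamma_pos_of_pos (by positivity)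
  have h2 : 0 < Real.Gamma (b / 2 + 1) := Real.Gamma_pos_of_pos (by positivity)
  have h3 := Real.pi_pos
  positivity

/-- The quotient `2 √π Γ(1 + b/2) / (3 Γ((1 + b)/2))`. -/
def gammaQuotient (b : ℝ) : ℝ :=
  2 * √Real.pi * Real.Gamma (1 + b / 2) / (3 * Real.Gamma ((1 + b) / 2))

theorem gammaQuotient_pos {b : ℝ} (hb : 0 < b) : 0 < gammaQuotient b := by
  have h1 : 0 < Real.Gamma ((1 + b) / 2) := Real.Gamma_pos_of_pos (by positivity)
  have h2 : 0 < Real.Gamma (1 + b / 2) := Real.Gamma_pos_of_pos (by positivity)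
  have h3 := Real.pi_pos
  unfold gammaQuotient
  positivity

/-- The constant 2/3 is the energy of three points at mutual distance 1, and 2^b compensates for the
diameter of the unit disk; this links the disk to the triangle. -/
theorem circleMean_mul_gammaQuotient {b : ℝ} (hb : 0 < b) :
    circleMean b * gammaQuotient b = 2 ^ b * (2 / 3) := by
  have h1 : 0 < Real.Gamma ((1 + b) / 2) := Real.Gamma_pos_of_pos (by positivity)
  have h2 : 0 < Real.Gamma (1 + b / 2) := Real.Gamma_pos_of_pos (by positivity)
  have h3 : 0 < √Real.pi := Real.sqrt_pos.2 Real.pi_pos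
  rw [circleMean_eq hb, gammaQuotient, add_comm b 1, add_comm (b / 2) 1]
  field_simp

open Real in
theorem gammaQuotient_eq {b : ℝ} (hb : 0 < b) :
    gammaQuotient b = 4 * π / 3 / ∫ θ in (-π)..π, |sin θ| ^ b := by
  have h1 : 0 < Gamma ((1 + b) / 2) := Gamma_pos_of_pos (by positivity)
  have h2 : 0 < Gamma (1 + b / 2) := Gamma_pos_of_pos (by positivity)
  have h3 : 0 < √π := sqrt_pos.2 pi_pos
  have hs : √π ^ 2 = π := sq_sqrt pi_pos.le
  rw [integral_abs_sin_rpow hb, gammaQuotient, add_comm b 1, add_comm (b / 2) 1]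
  field_simp
  rw [hs]
  ring

-- The integral of |sin|^b decreases strictly in b because |sin| ≤ 1, with strict inequality at π/6;
-- `gammaQuotient` is a positive constant divided by it.
open Real in
theorem gammaQuotient_lt {b c : ℝ} (hb : 0 < b) (hbc : b < c) :
    gammaQuotient b < gammaQuotient c := by
  have hc : 0 < c := hb.trans hbc
  have hcont : ∀ d : ℝ, 0 < d → Continuous fun θ : ℝ => |sin θ| ^ d := fun d hd =>
    continuous_sin.abs.rpow_const fun _ => Or.inr hd.le
  have hle : ∀ θ : ℝ, |sin θ| ^ c ≤ |sin θ| ^ b := fun θ =>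
    rpow_le_rpow_of_exponent_ge' (abs_nonneg _) (abs_sin_le_one θ) hb.le hbc.le
  have hlt : ∫ θ in (-π)..π, |sin θ| ^ c < ∫ θ in (-π)..π, |sin θ| ^ b := by
    refine intervalIntegral.integral_lt_integral_of_continuousOn_of_le_of_exists_lt
      (by linarith [pi_pos]) (hcont c hc).continuousOn (hcont b hb).continuousOn
      (fun θ _ => hle θ) ⟨π / 6, ⟨by linarith [pi_pos], by linarith [pi_pos]⟩, ?_⟩
    rw [sin_pi_div_six, abs_of_pos (by norm_num)]
    exact rpow_lt_rpow_of_exponent_gt (by norm_num) (by norm_num) hbc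
  have hpos : 0 < ∫ θ in (-π)..π, |sin θ| ^ c := by
    have h1 : 0 < Gamma ((c + 1) / 2) := Gamma_pos_of_pos (by positivity)
    have h2 : 0 < Gamma (c / 2 + 1) := Gamma_pos_of_pos (by positivity)
    have h3 := pi_pos
    rw [integral_abs_sin_rpow hc]
    positivity
  rw [gammaQuotient_eq hb, gammaQuotient_eq hc]
  have := pi_pos
  gcongr

theorem continuousOn_gammaQuotient : ContinuousOn gammaQuotient (Set.Ioi 0) := by
  intro b hb
  have hb : 0 < b := hb
  have h1 : 0 < Real.Gamma ((1 + b) / 2) := Real.Gamma_pos_of_pos (by positivity)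
  have c1 : ContinuousAt Real.Gamma (1 + b / 2) :=
    (Real.differentiableAt_Gamma fun m => by
      have : (0 : ℝ) ≤ m := m.cast_nonneg
      have : 0 < b := hb
      intro h
      linarith).continuousAt
  have c2 : ContinuousAt Real.Gamma ((1 + b) / 2) :=
    (Real.differentiableAt_Gamma fun m => by
      have : (0 : ℝ) ≤ m := m.cast_nonneg
      have : 0 < b := hb
      intro h
      linarith).continuousAt
  have c1' : ContinuousAt (fun b : ℝ => Real.Gamma (1 + b / 2)) b :=
    ContinuousAt.comp (f := fun b : ℝ => 1 + b / 2) c1 (by fun_prop)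
  have c2' : ContinuousAt (fun b : ℝ => Real.Gamma ((1 + b) / 2)) b :=
    ContinuousAt.comp (f := fun b : ℝ => (1 + b) / 2) c2 (by fun_prop)
  refine ContinuousAt.continuousWithinAt ?_
  exact (continuousAt_const.mul c1').div (continuousAt_const.mul c2') (by positivity)

/-! ### Numerical location of the root of `gammaQuotient b = 1` -/

/-- The square of `Γ(x + 1/2) / Γ(x)`. -/
def gammaHalfStepSq (x : ℝ) : ℝ := (Real.Gamma (x + 1 / 2) / Real.Gamma x) ^ 2

theorem gammaHalfStepSq_pos {x : ℝ} (hx : 0 < x) : 0 < gammaHalfStepSq x := by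
  have h1 : 0 < Real.Gamma x := Real.Gamma_pos_of_pos hx
  have h2 : 0 < Real.Gamma (x + 1 / 2) := Real.Gamma_pos_of_pos (by positivity)
  unfold gammaHalfStepSq
  positivity

theorem gammaHalfStepSq_add_one {x : ℝ} (hx : 0 < x) :
    gammaHalfStepSq (x + 1) = gammaHalfStepSq x * ((x + 1 / 2) / x) ^ 2 := by
  have h1 : 0 < Real.Gamma x := Real.Gamma_pos_of_pos hx
  unfold gammaHalfStepSq
  rw [show x + 1 + 1 / 2 = (x + 1 / 2) + 1 by ring, Real.Gamma_add_one (by positivity),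
    Real.Gamma_add_one hx.ne']
  field_simp

theorem gammaHalfStepSq_mul {x : ℝ} (hx : 0 < x) :
    gammaHalfStepSq x * gammaHalfStepSq (x + 1 / 2) = x ^ 2 := by
  have h1 : 0 < Real.Gamma x := Real.Gamma_pos_of_pos hx
  have h2 : 0 < Real.Gamma (x + 1 / 2) := Real.Gamma_pos_of_pos (by positivity)
  unfold gammaHalfStepSq
  rw [show x + 1 / 2 + 1 / 2 = x + 1 by ring, Real.Gamma_add_one hx.ne']
  field_simp

/-- Log-convexity of Γ at the midpoint x of x - 1/2 and x + 1/2. The bound is crude, but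
asymptotically sharp to first order, which is what the sharper estimate needs. -/
theorem sub_half_le_gammaHalfStepSq {x : ℝ} (hx : 1 / 2 < x) :
    x - 1 / 2 ≤ gammaHalfStepSq x := by
  have hx0 : 0 < x - 1 / 2 := by linarith
  have h0 : 0 < Real.Gamma (x - 1 / 2) := Real.Gamma_pos_of_pos hx0
  have h1 : 0 < Real.Gamma x := Real.Gamma_pos_of_pos (by linarith)
  have h2 : 0 < Real.Gamma (x + 1 / 2) := Real.Gamma_pos_of_pos (by linarith)
  have h := Real.Gamma_mul_add_mul_le_rpow_Gamma_mul_rpow_Gamma (s := x - 1 / 2)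
    (t := x + 1 / 2) (a := 1 / 2) (b := 1 / 2) hx0 (by linarith) (by norm_num) (by norm_num)
    (by norm_num)
  rw [show 1 / 2 * (x - 1 / 2) + 1 / 2 * (x + 1 / 2) = x by ring, ← Real.sqrt_eq_rpow,
    ← Real.sqrt_eq_rpow, ← Real.sqrt_mul h0.le] at h
  have h3 : Real.Gamma x ^ 2 ≤ Real.Gamma (x - 1 / 2) * Real.Gamma (x + 1 / 2) := by
    rw [← Real.sq_sqrt (mul_pos h0 h2).le]
    gcongr
  have h4 : Real.Gamma (x + 1 / 2) = (x - 1 / 2) * Real.Gamma (x - 1 / 2) := by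
    rw [← Real.Gamma_add_one hx0.ne']
    congr 1
    ring
  unfold gammaHalfStepSq
  rw [div_pow, le_div_iff₀ (by positivity)]
  calc (x - 1 / 2) * Real.Gamma x ^ 2
      ≤ (x - 1 / 2) * (Real.Gamma (x - 1 / 2) * Real.Gamma (x + 1 / 2)) := by gcongr
    _ = Real.Gamma (x + 1 / 2) ^ 2 := by rw [sq, ← mul_assoc, ← h4]

/-- The quotient of the two sides does not increase under x ↦ x + 1, and by the crude bound its
limit along x + n is at least 1; so it is at least 1 at x. -/
theorem sub_quarter_le_gammaHalfStepSq {x : ℝ} (hx : 1 / 4 < x) :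
    x - 1 / 4 ≤ gammaHalfStepSq x := by
  have key : ∀ n : ℕ, gammaHalfStepSq (x + n) / (x + n - 1 / 4) ≤
      gammaHalfStepSq x / (x - 1 / 4) := by
    intro n
    induction n with
    | zero => simp
    | succ n ih =>
      refine le_trans ?_ ih
      set y : ℝ := x + n with hy
      have hy4 : 1 / 4 < y := by have : (0 : ℝ) ≤ n := n.cast_nonneg; linarith
      have hy0 : 0 < y := by linarith
      rw [show x + ((n + 1 : ℕ) : ℝ) = y + 1 by push_cast; ring, gammaHalfStepSq_add_one hy0]
      rw [div_le_div_iff₀ (by linarith) (by linarith), mul_assoc]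
      have hf := gammaHalfStepSq_pos hy0
      gcongr
      rw [div_pow, div_mul_eq_mul_div, div_le_iff₀ (by positivity)]
      -- After clearing denominators: (y + 1/2)² (y - 1/4) = y² (y + 3/4) - 1/16.
      nlinarith
  have hlim : Filter.Tendsto (fun n : ℕ => 1 - (1 / 4) / (x - 1 / 4 + (n : ℝ))) Filter.atTop
      (nhds (1 - 0)) := by
    refine tendsto_const_nhds.sub (tendsto_const_nhds.div_atTop ?_)
    exact Filter.tendsto_atTop_add_const_left _ _ tendsto_natCast_atTop_atTop
  have h1 : 1 - 0 ≤ gammaHalfStepSq x / (x - 1 / 4) := by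
    refine le_of_tendsto hlim (Filter.eventually_atTop.2 ⟨1, fun n hn => le_trans ?_ (key n)⟩)
    have hn' : (1 : ℝ) ≤ n := by exact_mod_cast hn
    have hd : 0 < x + n - 1 / 4 := by linarith
    have := sub_half_le_gammaHalfStepSq (x := x + n) (by linarith)
    rw [show x - 1 / 4 + (n : ℝ) = x + n - 1 / 4 by ring, le_div_iff₀ hd, sub_mul,
      div_mul_cancel₀ _ hd.ne']
    linarith
  rw [sub_zero, le_div_iff₀ (by linarith)] at h1
  linarith

/-- The product formula `gammaHalfStepSq_mul` turns the lower bound at x + 1/2 into an upper bound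
at x. -/
theorem gammaHalfStepSq_le {x : ℝ} (hx : 0 < x) : gammaHalfStepSq x ≤ x ^ 2 / (x + 1 / 4) := by
  have h := sub_quarter_le_gammaHalfStepSq (x := x + 1 / 2) (by linarith)
  have h0 := gammaHalfStepSq_pos hx
  rw [le_div_iff₀ (by positivity), ← gammaHalfStepSq_mul hx]
  gcongr
  linarith

/-- Moves the evaluation to a large argument y, where the upper and lower bounds differ only by the
factor 1 / (1 - 1/(16y²)). -/
theorem gammaHalfStepSq_eq_prod {x : ℝ} (hx : 0 < x) (n : ℕ) :
    gammaHalfStepSq x =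
      gammaHalfStepSq (x + n) * ∏ k ∈ Finset.range n, ((x + k) / (x + k + 1 / 2)) ^ 2 := by
  induction n with
  | zero => simp
  | succ n ih =>
    have hy : 0 < x + n := by positivity
    rw [Finset.prod_range_succ, ih,
      show x + ((n + 1 : ℕ) : ℝ) = x + n + 1 by push_cast; ring, gammaHalfStepSq_add_one hy]
    have h1 : ((x + n + 1 / 2) / (x + n)) ^ 2 * ((x + n) / (x + n + 1 / 2)) ^ 2 = 1 := by
      field_simp
    linear_combination
      (-gammaHalfStepSq (x + n) * ∏ k ∈ Finset.range n, ((x + k) / (x + k + 1 / 2)) ^ 2) * h1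

theorem gammaQuotient_sq {b : ℝ} :
    gammaQuotient b ^ 2 = 4 * Real.pi / 9 * gammaHalfStepSq ((1 + b) / 2) := by
  unfold gammaQuotient gammaHalfStepSq
  rw [show (1 + b) / 2 + 1 / 2 = 1 + b / 2 by ring]
  simp only [div_pow, mul_pow, Real.sq_sqrt Real.pi_pos.le]
  ring

theorem gammaQuotient_lt_one : gammaQuotient 0.8555 < 1 := by
  -- With 24 shifts the argument is about 25 and the relative error about 10⁻⁴, fine enough to
  -- decide the sign at distance 0.0005 from 0.856.
  have h1 := gammaHalfStepSq_eq_prod (x := (1 + 0.8555) / 2) (by norm_num) 24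
  have h2 := gammaHalfStepSq_le (x := (1 + 0.8555) / 2 + (24 : ℕ)) (by norm_num)
  have h3 : gammaQuotient 0.8555 ^ 2 < 1 := by
    rw [gammaQuotient_sq, h1]
    calc _ ≤ 4 * 3.141593 / 9 * ((((1 + 0.8555) / 2 + (24 : ℕ)) ^ 2 /
          ((1 + 0.8555) / 2 + (24 : ℕ) + 1 / 4)) * ∏ k ∈ Finset.range 24,
            (((1 + 0.8555) / 2 + (k : ℝ)) / ((1 + 0.8555) / 2 + (k : ℝ) + 1 / 2)) ^ 2 : ℝ) := by
          have := (gammaHalfStepSq_pos (x := (1 + 0.8555) / 2 + (24 : ℕ)) (by norm_num)).le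
          have : 0 ≤ ∏ k ∈ Finset.range 24,
            (((1 + 0.8555) / 2 + (k : ℝ)) / ((1 + 0.8555) / 2 + (k : ℝ) + 1 / 2)) ^ 2 :=
            Finset.prod_nonneg fun _ _ => by positivity
          gcongr
          exact Real.pi_lt_d6.le
      _ < 1 := by norm_num [Finset.prod_range_succ]
  exact (sq_lt_one_iff₀ (gammaQuotient_pos (by norm_num)).le).1 h3

theorem one_lt_gammaQuotient : 1 < gammaQuotient 0.8565 := by
  have h1 := gammaHalfStepSq_eq_prod (x := (1 + 0.8565) / 2) (by norm_num) 24
  have h2 := sub_quarter_le_gammaHalfStepSq (x := (1 + 0.8565) / 2 + (24 : ℕ)) (by norm_num)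
  have h3 : 1 < gammaQuotient 0.8565 ^ 2 := by
    rw [gammaQuotient_sq, h1]
    calc (1 : ℝ) < 4 * 3.141592 / 9 * (((1 + 0.8565) / 2 + (24 : ℕ) - 1 / 4) *
          ∏ k ∈ Finset.range 24,
            (((1 + 0.8565) / 2 + (k : ℝ)) / ((1 + 0.8565) / 2 + (k : ℝ) + 1 / 2)) ^ 2 : ℝ) := by
          norm_num [Finset.prod_range_succ]
      _ ≤ _ := by
          have : 0 ≤ ∏ k ∈ Finset.range 24,
            (((1 + 0.8565) / 2 + (k : ℝ)) / ((1 + 0.8565) / 2 + (k : ℝ) + 1 / 2)) ^ 2 :=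
            Finset.prod_nonneg fun _ _ => by positivity
          gcongr
          exact Real.pi_gt_d6.le
  exact (one_lt_sq_iff₀ (gammaQuotient_pos (by norm_num)).le).1 h3

theorem exists_gammaQuotient_eq_one :
    ∃ b : ℝ, 0.8555 < b ∧ b < 0.8565 ∧ gammaQuotient b = 1 := by
  have hc : ContinuousOn gammaQuotient (Set.Icc 0.8555 0.8565) :=
    continuousOn_gammaQuotient.mono fun x hx => lt_of_lt_of_le (by norm_num) hx.1
  obtain ⟨b, hb, hb1⟩ := intermediate_value_Ioo (by norm_num) hc
    ⟨gammaQuotient_lt_one, one_lt_gammaQuotient⟩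
  exact ⟨b, hb.1, hb.2, hb1⟩

/-! ### The potential of the uniform measure on the circle -/

open Complex Metric Real in
/-- The mean of the modulus of a zero-free holomorphic function over circles around the origin
satisfies the maximum principle. -/
theorem integral_norm_circle_le {f : ℂ → ℂ} (hf : DiffContOnCl ℂ f (ball 0 1))
    (hne : ∀ z ∈ ball (0 : ℂ) 1, f z ≠ 0) {C : ℝ}
    (hC : ∀ x : ℂ, ‖x‖ = 1 → ∫ θ in (-π)..π, ‖f (x * cexp (-θ * I))‖ ≤ C) {a : ℂ}
    (ha : ‖a‖ < 1) : ∫ θ in (-π)..π, ‖f (a * cexp (-θ * I))‖ ≤ C := by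
  have hπ : -π ≤ π := by linarith [pi_pos]
  have hcl : ContinuousOn f (closedBall 0 1) := by
    rw [← closure_ball (0 : ℂ) one_ne_zero]
    exact hf.continuousOn
  have hnorm : ∀ (x : ℂ) (θ : ℝ), ‖x * cexp (-θ * I)‖ = ‖x‖ := fun x θ => by
    rw [norm_mul, ← ofReal_neg, norm_exp_ofReal_mul_I, mul_one]
  have hmem : ∀ x ∈ closedBall (0 : ℂ) 1, ∀ θ : ℝ, x * cexp (-θ * I) ∈ closedBall (0 : ℂ) 1 :=
    fun x hx θ => by
      rw [mem_closedBall, dist_zero_right, hnorm]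
      simpa using hx
  have hmem' : ∀ x ∈ ball (0 : ℂ) 1, ∀ θ : ℝ, x * cexp (-θ * I) ∈ ball (0 : ℂ) 1 :=
    fun x hx θ => by
      rw [mem_ball, dist_zero_right, hnorm]
      simpa using hx
  have hcθ : ∀ x ∈ closedBall (0 : ℂ) 1, Continuous fun θ : ℝ => f (x * cexp (-θ * I)) :=
    fun x hx => hcl.comp_continuous (by fun_prop) (hmem x hx)
  have ha' : a ∈ ball (0 : ℂ) 1 := by simpa using ha
  -- The unimodular phase is frozen at the point a. The function h below is then holomorphic, is
  -- bounded by the circular mean of ‖f‖, and equals that mean at a, so the ordinary maximum modulus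
  -- principle applies to h.
  set g : ℝ → ℂ := fun θ => (‖f (a * cexp (-θ * I))‖ : ℂ) / f (a * cexp (-θ * I)) with hg
  have hgc : Continuous g :=
    (continuous_ofReal.comp (hcθ a (ball_subset_closedBall ha')).norm).div
      (hcθ a (ball_subset_closedBall ha')) fun θ => hne _ (hmem' a ha' θ)
  have hg1 : ∀ θ, ‖g θ‖ = 1 := fun θ => by
    have h0 := hne _ (hmem' a ha' θ)
    simp only [hg, norm_div, norm_real, norm_norm]
    exact div_self (norm_ne_zero_iff.2 h0)
  obtain ⟨M, hM⟩ := (isCompact_closedBall (0 : ℂ) 1).exists_bound_of_continuousOn hcl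
  set h : ℂ → ℂ := fun x => ∫ θ in (-π)..π, g θ * f (x * cexp (-θ * I)) with hh
  have hcint : ∀ x ∈ closedBall (0 : ℂ) 1, Continuous fun θ : ℝ => g θ * f (x * cexp (-θ * I)) :=
    fun x hx => hgc.mul (hcθ x hx)
  have hcont : ContinuousOn h (closedBall 0 1) := by
    intro x hx
    refine intervalIntegral.continuousWithinAt_of_dominated_interval (bound := fun _ => M)
      ?_ ?_ (continuous_const.intervalIntegrable _ _) ?_
    · filter_upwards [self_mem_nhdsWithin] with y hy
      exact (hcint y hy).aestronglyMeasurable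
    · filter_upwards [self_mem_nhdsWithin] with y hy
      refine Filter.Eventually.of_forall fun θ _ => ?_
      rw [norm_mul, hg1, one_mul]
      exact hM _ (hmem y hy θ)
    · refine Filter.Eventually.of_forall fun θ _ => continuousWithinAt_const.mul ?_
      exact (hcl.comp (f := fun x : ℂ => x * cexp (-θ * I)) (by fun_prop)
        fun y hy => hmem y hy θ) x hx
  have hderiv : ContinuousOn (deriv f) (ball 0 1) :=
    (hf.differentiableOn.deriv isOpen_ball).continuousOn
  have hdiff : DifferentiableOn ℂ h (ball 0 1) := by
    intro x hx
    have hx1 : ‖x‖ < 1 := by simpa using hx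
    set ρ : ℝ := (1 + ‖x‖) / 2 with hρ
    have hρ1 : ρ < 1 := by linarith
    have hsub : closedBall (0 : ℂ) ρ ⊆ ball 0 1 := closedBall_subset_ball hρ1
    obtain ⟨N, hN⟩ := (isCompact_closedBall (0 : ℂ) ρ).exists_bound_of_continuousOn
      (hderiv.mono hsub)
    have hxρ : ball (0 : ℂ) ρ ∈ nhds x := isOpen_ball.mem_nhds (by
      simp only [mem_ball, dist_zero_right]
      linarith)
    have key := intervalIntegral.hasDerivAt_integral_of_dominated_loc_of_deriv_le
      (μ := volume) (a := -π) (b := π)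
      (F := fun (x : ℂ) (θ : ℝ) => g θ * f (x * cexp (-θ * I)))
      (F' := fun (x : ℂ) (θ : ℝ) => g θ * (deriv f (x * cexp (-θ * I)) * cexp (-θ * I)))
      (x₀ := x) (bound := fun _ => N) hxρ ?_ ?_ ?_ ?_ (continuous_const.intervalIntegrable _ _) ?_
    · exact key.2.differentiableAt.differentiableWithinAt
    · filter_upwards [isOpen_ball.mem_nhds hx] with y hy
      exact (hcint y (ball_subset_closedBall hy)).aestronglyMeasurable
    · exact (hcint x (ball_subset_closedBall hx)).intervalIntegrable _ _
    · have hd : Continuous fun θ : ℝ => deriv f (x * cexp (-θ * I)) :=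
        hderiv.comp_continuous (by fun_prop) (hmem' x hx)
      exact (hgc.mul (hd.mul (by fun_prop))).aestronglyMeasurable
    · refine Filter.Eventually.of_forall fun θ _ y hy => ?_
      rw [norm_mul, norm_mul, hg1, ← ofReal_neg, norm_exp_ofReal_mul_I, one_mul, mul_one]
      refine hN _ ?_
      have hy' : ‖y‖ < ρ := by simpa using hy
      rw [mem_closedBall, dist_zero_right, ofReal_neg, hnorm]
      exact hy'.le
    · refine Filter.Eventually.of_forall fun θ _ y hy => ?_
      have hy' := hmem' y (hsub (ball_subset_closedBall hy)) θ
      have h1 := (hf.differentiableOn.differentiableAt (isOpen_ball.mem_nhds hy')).hasDerivAt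
      have h2 : HasDerivAt (fun y : ℂ => y * cexp (-θ * I)) (cexp (-θ * I)) y := by
        simpa using (hasDerivAt_id y).mul_const (cexp (-θ * I))
      exact (h1.comp y h2).const_mul (g θ)
  have hbound : ∀ z ∈ frontier (ball (0 : ℂ) 1), ‖h z‖ ≤ C := by
    intro z hz
    rw [frontier_ball _ one_ne_zero, mem_sphere_zero_iff_norm] at hz
    refine le_trans (intervalIntegral.norm_integral_le_integral_norm hπ) ?_
    simp only [norm_mul, hg1, one_mul]
    have := hC z hz
    simpa only [norm_mul] using this
  have hha : h a = ((∫ θ in (-π)..π, ‖f (a * cexp (-θ * I))‖ : ℝ) : ℂ) := by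
    rw [hh, ← intervalIntegral.integral_ofReal]
    refine intervalIntegral.integral_congr fun θ _ => ?_
    exact div_mul_cancel₀ _ (hne _ (hmem' a ha' θ))
  have hfin := norm_le_of_forall_mem_frontier_norm_le (U := ball (0 : ℂ) 1) isBounded_ball
    ⟨hdiff, by rwa [closure_ball _ one_ne_zero]⟩ hbound (subset_closure ha')
  rw [hha, norm_real] at hfin
  exact (le_abs_self _).trans hfin

open Complex Metric Real in
theorem integral_norm_sub_circle_of_norm_eq_one {b : ℝ} {x : ℂ} (hx : ‖x‖ = 1) :
    ∫ θ in (-π)..π, ‖x - cexp (θ * I)‖ ^ b = 2 * π * circleMean b := by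
  obtain ⟨t, rfl⟩ : ∃ t : ℝ, x = cexp (t * I) := ⟨arg x, by
    conv_lhs => rw [← norm_mul_exp_arg_mul_I x]
    rw [hx, ofReal_one, one_mul]⟩
  have hper : Function.Periodic (fun θ : ℝ => |2 * Real.sin (θ / 2)| ^ b) (2 * π) := fun θ => by
    simp only
    rw [show (θ + 2 * π) / 2 = θ / 2 + π by ring, Real.sin_add_pi, mul_neg, abs_neg]
  have h1 : ∀ θ : ℝ, ‖cexp (t * I) - cexp (θ * I)‖ ^ b = |2 * Real.sin ((θ - t) / 2)| ^ b := by
    intro θ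
    congr 1
    rw [norm_sub_rev, show cexp (θ * I) - cexp (t * I) =
        cexp (t * I) * (cexp (I * ((θ - t : ℝ) : ℂ)) - 1) by
      rw [mul_sub, ← Complex.exp_add, mul_one]
      congr 2
      push_cast
      ring]
    rw [norm_mul, norm_exp_ofReal_mul_I, one_mul, norm_exp_I_mul_ofReal_sub_one, Real.norm_eq_abs]
  simp only [h1]
  rw [intervalIntegral.integral_comp_sub_right (fun θ => |2 * Real.sin (θ / 2)| ^ b) t,
    circleMean, mul_inv_cancel_left₀ (by positivity)]
  have e := hper.intervalIntegral_add_eq (-π - t) (-π)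
  rwa [show -π - t + 2 * π = π - t by ring, show -π + 2 * π = π by ring] at e

-- On the circle ‖x - e^(iθ)‖ = ‖1 - x e^(-iθ)‖, and (1 - z)^b is holomorphic and zero-free in the
-- unit disk because Re(1 - z) > 0 there. The maximum principle for circular means then compares x
-- with boundary points, where the mean is constant by rotation.
open Complex Metric Real in
theorem integral_norm_sub_circle_le {b : ℝ} (hb : 0 < b) {x : ℂ} (hx : ‖x‖ ≤ 1) :
    ∫ θ in (-π)..π, ‖x - cexp (θ * I)‖ ^ b ≤ 2 * π * circleMean b := by
  rcases hx.eq_or_lt with hx | hx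
  · exact (integral_norm_sub_circle_of_norm_eq_one hx).le
  have hrw : ∀ (x : ℂ) (θ : ℝ), ‖x - cexp (θ * I)‖ ^ b =
      ‖(1 - x * cexp (-θ * I)) ^ (b : ℂ)‖ := by
    intro x θ
    rw [norm_cpow_real, norm_sub_rev, show cexp (θ * I) - x =
      cexp (θ * I) * (1 - x * cexp (-θ * I)) by
        rw [mul_sub, mul_left_comm, ← Complex.exp_add]
        simp]
    rw [norm_mul, norm_exp_ofReal_mul_I, one_mul]
  have hre : ∀ z : ℂ, z.re ≤ ‖z‖ := re_le_norm
  simp only [hrw]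
  refine integral_norm_circle_le (f := fun z => (1 - z) ^ (b : ℂ)) ⟨?_, ?_⟩ ?_ ?_ hx
  · intro z hz
    have hz1 : ‖z‖ < 1 := by simpa using hz
    have hs : 1 - z ∈ slitPlane := Or.inl (by
      have := hre z
      rw [sub_re, one_re]
      linarith)
    exact (((hasDerivAt_id z).const_sub 1).cpow_const hs).differentiableAt.differentiableWithinAt
  · rw [closure_ball _ one_ne_zero]
    intro z hz
    have hz1 : ‖z‖ ≤ 1 := by simpa using hz
    have hs : 0 ≤ (1 - z).re := by
      have := hre z
      rw [sub_re, one_re]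
      linarith
    refine ContinuousAt.continuousWithinAt ?_
    exact ContinuousAt.comp (f := fun z : ℂ => 1 - z) (g := fun z : ℂ => z ^ (b : ℂ))
      (continuousAt_cpow_const_of_re_pos (Or.inl hs) (by simpa using hb)) (by fun_prop)
  · intro z hz h0
    have hz1 : ‖z‖ < 1 := by simpa using hz
    rw [cpow_eq_zero_iff] at h0
    have h1 : z = 1 := (sub_eq_zero.1 h0.1).symm
    simp [h1] at hz1
  · intro y hy
    simp only [← hrw]
    exact (integral_norm_sub_circle_of_norm_eq_one hy).le

/-- The uniform probability measure on the unit circle. -/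
def circleMeasure : Measure ℂ :=
  (ENNReal.ofReal (2 * Real.pi)⁻¹ • volume.restrict (Set.Ioc (-Real.pi) Real.pi)).map
    fun θ : ℝ => Complex.exp (θ * Complex.I)

theorem lintegral_circleMeasure {f : ℂ → ℝ≥0∞} (hf : Measurable f) :
    ∫⁻ z, f z ∂circleMeasure = ENNReal.ofReal (2 * Real.pi)⁻¹ *
      ∫⁻ θ in Set.Ioc (-Real.pi) Real.pi, f (Complex.exp ((θ : ℝ) * Complex.I)) := by
  rw [circleMeasure, lintegral_map hf (by fun_prop), lintegral_smul_measure, smul_eq_mul]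

instance : IsProbabilityMeasure circleMeasure := ⟨by
  have h := lintegral_circleMeasure (f := fun _ => 1) measurable_const
  have hp := Real.pi_pos
  rw [lintegral_const, one_mul, lintegral_const, one_mul, Measure.restrict_apply_univ,
    Real.volume_Ioc, ← ENNReal.ofReal_mul (by positivity),
    show (2 * Real.pi)⁻¹ * (Real.pi - -Real.pi) = 1 by field_simp; ring, ENNReal.ofReal_one] at h
  exact h⟩

theorem lintegral_norm_sub_circleMeasure {b : ℝ} (hb : 0 < b) (x : ℂ) :
    ∫⁻ y, ENNReal.ofReal (‖x - y‖ ^ b) ∂circleMeasure = ENNReal.ofReal ((2 * Real.pi)⁻¹ *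
      ∫ θ in (-Real.pi)..Real.pi, ‖x - Complex.exp (θ * Complex.I)‖ ^ b) := by
  have hp := Real.pi_pos
  have hc : Continuous fun θ : ℝ => ‖x - Complex.exp (θ * Complex.I)‖ ^ b :=
    Continuous.rpow_const (by fun_prop) fun _ => Or.inr hb.le
  rw [lintegral_circleMeasure (by fun_prop), ENNReal.ofReal_mul (by positivity),
    intervalIntegral.integral_of_le (by linarith), ofReal_integral_eq_lintegral_ofReal]
  · exact hc.integrableOn_Ioc
  · exact Filter.Eventually.of_forall fun θ => by simp only [Pi.zero_apply]; positivity

theorem lintegral_norm_sub_circleMeasure_le {b : ℝ} (hb : 0 < b) {x : ℂ} (hx : ‖x‖ ≤ 1) :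
    ∫⁻ y, ENNReal.ofReal (‖x - y‖ ^ b) ∂circleMeasure ≤ ENNReal.ofReal (circleMean b) := by
  have hp := Real.pi_pos
  rw [lintegral_norm_sub_circleMeasure hb]
  refine ENNReal.ofReal_le_ofReal ?_
  rw [inv_mul_le_iff₀ (by positivity)]
  exact integral_norm_sub_circle_le hb hx

theorem lintegral_norm_sub_circleMeasure_eq {b : ℝ} (hb : 0 < b) {x : ℂ} (hx : ‖x‖ = 1) :
    ∫⁻ y, ENNReal.ofReal (‖x - y‖ ^ b) ∂circleMeasure = ENNReal.ofReal (circleMean b) := by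
  have hp := Real.pi_pos
  rw [lintegral_norm_sub_circleMeasure hb, integral_norm_sub_circle_of_norm_eq_one hx,
    inv_mul_cancel_left₀ (by positivity)]

theorem lintegral_lintegral_circleMeasure {b : ℝ} (hb : 0 < b) :
    ∫⁻ x, ∫⁻ y, ENNReal.ofReal (‖x - y‖ ^ b) ∂circleMeasure ∂circleMeasure =
      ENNReal.ofReal (circleMean b) := by
  have hae : ∀ᵐ x ∂circleMeasure, ‖x‖ = 1 := by
    unfold circleMeasure
    rw [ae_map_iff (by fun_prop) (measurableSet_eq_fun (by fun_prop) (by fun_prop))]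
    exact Filter.Eventually.of_forall fun θ => Complex.norm_exp_ofReal_mul_I θ
  rw [lintegral_congr_ae (hae.mono fun x hx => lintegral_norm_sub_circleMeasure_eq hb hx)]
  simp

/-! ### Conditional negative definiteness of the kernel and the extremal measure on the disk -/

/-- The integrand of the representation of `‖x‖ ^ b` as a superposition of functions
`1 - cos ⟪x, ξ⟫`. -/
def cosKernel (b : ℝ) (x ξ : ℂ) : ℝ≥0∞ :=
  ENNReal.ofReal (1 - Real.cos (inner ℝ x ξ)) * ENNReal.ofReal (‖ξ‖ ^ (-2 - b))

theorem measurable_cosKernel (b : ℝ) (x : ℂ) : Measurable fun ξ => cosKernel b x ξ := by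
  unfold cosKernel
  fun_prop

theorem lintegral_comp_smul_complex {f : ℂ → ℝ≥0∞} (hf : Measurable f) {r : ℝ} (hr : 0 < r) :
    ∫⁻ ξ, f (r • ξ) = ENNReal.ofReal ((r ^ 2)⁻¹) * ∫⁻ ξ, f ξ := by
  have h := Measure.map_addHaar_smul (volume : Measure ℂ) hr.ne'
  rw [Complex.finrank_real_complex, abs_of_pos (by positivity)] at h
  rw [← lintegral_map hf (measurable_const_smul r), h, lintegral_smul_measure, smul_eq_mul]

theorem lintegral_cosKernel_smul (b : ℝ) {r : ℝ} (hr : 0 < r) (x : ℂ) :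
    ∫⁻ ξ, cosKernel b (r • x) ξ = ENNReal.ofReal (r ^ b) * ∫⁻ ξ, cosKernel b x ξ := by
  have hm := measurable_cosKernel b x
  have h : ∀ ξ, cosKernel b (r • x) ξ = ENNReal.ofReal (r ^ (2 + b)) * cosKernel b x (r • ξ) := by
    intro ξ
    have h1 : ‖ξ‖ ^ (-2 - b) = r ^ (2 + b) * ‖r • ξ‖ ^ (-2 - b) := by
      rw [norm_smul, Real.norm_of_nonneg hr.le, Real.mul_rpow hr.le (norm_nonneg _), ← mul_assoc,
        ← Real.rpow_add hr, show 2 + b + (-2 - b) = 0 by ring, Real.rpow_zero, one_mul]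
    unfold cosKernel
    rw [h1, ENNReal.ofReal_mul (by positivity), real_inner_smul_left, real_inner_smul_right,
      mul_left_comm]
  simp only [h]
  have hm' : Measurable fun ξ => cosKernel b x (r • ξ) := by
    unfold cosKernel
    fun_prop
  rw [lintegral_const_mul _ hm', lintegral_comp_smul_complex hm hr,
    ← mul_assoc, ← ENNReal.ofReal_mul (by positivity), Real.rpow_add hr, Real.rpow_two]
  congr 2
  field_simp

theorem lintegral_cosKernel_rotation (b : ℝ) (u : Circle) (x : ℂ) :
    ∫⁻ ξ, cosKernel b (rotation u x) ξ = ∫⁻ ξ, cosKernel b x ξ := by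
  have h : ∀ ξ, cosKernel b (rotation u x) ξ = cosKernel b x ((rotation u).symm ξ) := by
    intro ξ
    unfold cosKernel
    rw [LinearIsometryEquiv.norm_map, ← LinearIsometryEquiv.inner_map_map (rotation u).symm,
      LinearIsometryEquiv.symm_apply_apply]
  simp only [h]
  exact ((rotation u).symm.measurePreserving).lintegral_comp (measurable_cosKernel b x)

/-- The left side is rotation invariant and homogeneous of degree b in x, hence a multiple of ‖x‖^b.
The multiple is positive and, for 0 < b < 2, finite, so it can later be cancelled. -/
theorem lintegral_cosKernel {b : ℝ} (hb : 0 < b) (x : ℂ) :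
    ∫⁻ ξ, cosKernel b x ξ = ENNReal.ofReal (‖x‖ ^ b) * ∫⁻ ξ, cosKernel b 1 ξ := by
  rcases eq_or_ne x 0 with rfl | hx
  · simp [cosKernel, Real.zero_rpow hb.ne']
  have hx0 : 0 < ‖x‖ := norm_pos_iff.2 hx
  have h : x = ‖x‖ • rotation (Circle.exp (Complex.arg x)) 1 := by
    rw [rotation_apply, mul_one, Circle.coe_exp, Complex.real_smul, Complex.norm_mul_exp_arg_mul_I]
  conv_lhs => rw [h]
  rw [lintegral_cosKernel_smul b hx0, lintegral_cosKernel_rotation]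

theorem lintegral_cosKernel_one_ne_zero (b : ℝ) : ∫⁻ ξ, cosKernel b 1 ξ ≠ 0 := by
  have hm := measurable_cosKernel b 1
  intro h0
  rw [lintegral_eq_zero_iff hm, Filter.EventuallyEq, ae_iff] at h0
  have hsub : Metric.ball (1 : ℂ) 1 ⊆ {ξ | ¬ cosKernel b 1 ξ = (0 : ℂ → ℝ≥0∞) ξ} := by
    intro ξ hξ
    have h1 : |ξ.re - 1| < 1 := by
      rw [mem_ball_iff_norm] at hξ
      exact lt_of_le_of_lt (by simpa using Complex.abs_re_le_norm (ξ - 1)) hξ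
    have h2 := abs_lt.1 h1
    have hξ0 : ξ ≠ 0 := fun h => by simp [h] at h1
    have hn : 0 < ‖ξ‖ := norm_pos_iff.2 hξ0
    have hin : inner ℝ (1 : ℂ) ξ = ξ.re := by simp [Complex.inner]
    have hcos : Real.cos ξ.re < 1 := by
      rw [← Real.cos_zero]
      exact Real.cos_lt_cos_of_nonneg_of_le_pi le_rfl (by linarith [Real.pi_gt_three])
        (by linarith)
    simp only [Set.mem_ofPred_eq, Pi.zero_apply, cosKernel, hin, mul_eq_zero, not_or,
      ENNReal.ofReal_eq_zero, not_le]
    exact ⟨by linarith, by positivity⟩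
  have := measure_mono_null hsub h0
  exact (Metric.measure_ball_pos volume (1 : ℂ) one_pos).ne' this

theorem lintegral_cosKernel_one_ne_top {b : ℝ} (hb : 0 < b) (hb2 : b < 2) :
    ∫⁻ ξ, cosKernel b 1 ξ ≠ ∞ := by
  -- A radial majorant from 1 - cos t ≤ t² near the origin and 1 - cos t ≤ 2 far away. In polar
  -- coordinates b < 2 gives convergence at 0 and b > 0 at infinity.
  set k : ℝ → ℝ := fun y => if y ≤ 1 then y ^ (-b) else 2 * y ^ (-2 - b) with hk
  have hint : Integrable (fun ξ : ℂ => k ‖ξ‖) volume := by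
    rw [integrable_fun_norm_addHaar, Complex.finrank_real_complex,
      ← Set.Ioc_union_Ioi_eq_Ioi zero_le_one]
    refine IntegrableOn.union ?_ ?_
    · have h1 : IntegrableOn (fun y : ℝ => y ^ (1 - b)) (Set.Ioc 0 1) :=
        (intervalIntegral.intervalIntegrable_rpow' (by linarith)).1
      refine h1.congr_fun (fun y hy => ?_) measurableSet_Ioc
      simp only [hk, if_pos hy.2, Nat.add_one_sub_one, pow_one, smul_eq_mul]
      rw [sub_eq_add_neg, Real.rpow_add hy.1, Real.rpow_one]
    · have h1 : IntegrableOn (fun y : ℝ => 2 * y ^ (-1 - b)) (Set.Ioi 1) :=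
        (integrableOn_Ioi_rpow_of_lt (by linarith) one_pos).const_mul 2
      refine h1.congr_fun (fun y hy => ?_) measurableSet_Ioi
      have hy1 : (1 : ℝ) < y := hy
      have hy0 : (0 : ℝ) < y := by linarith
      simp only [hk, if_neg hy1.not_ge, Nat.add_one_sub_one, pow_one, smul_eq_mul]
      rw [show -1 - b = 1 + (-2 - b) by ring, Real.rpow_add hy0, Real.rpow_one]
      ring
  have hle : ∀ ξ, cosKernel b 1 ξ ≤ ENNReal.ofReal (k ‖ξ‖) := by
    intro ξ
    unfold cosKernel
    have hc : 0 ≤ 1 - Real.cos (inner ℝ (1 : ℂ) ξ) := by linarith [Real.cos_le_one (inner ℝ 1 ξ)]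
    rw [← ENNReal.ofReal_mul hc]
    refine ENNReal.ofReal_le_ofReal ?_
    have hin : |inner ℝ (1 : ℂ) ξ| ≤ ‖ξ‖ := by simpa using abs_real_inner_le_norm (1 : ℂ) ξ
    simp only [hk]
    split_ifs with h
    · rcases eq_or_ne ξ 0 with rfl | hξ
      · simp [Real.zero_rpow (show -b ≠ 0 by linarith)]
      have hn : 0 < ‖ξ‖ := norm_pos_iff.2 hξ
      have h1 : 1 - Real.cos (inner ℝ (1 : ℂ) ξ) ≤ ‖ξ‖ ^ 2 := by
        have h2 := Real.one_sub_sq_div_two_le_cos (x := inner ℝ (1 : ℂ) ξ)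
        have h3 : (inner ℝ (1 : ℂ) ξ) ^ 2 ≤ ‖ξ‖ ^ 2 := sq_le_sq' (abs_le.1 hin).1 (abs_le.1 hin).2
        linarith [sq_nonneg (inner ℝ (1 : ℂ) ξ)]
      calc _ ≤ ‖ξ‖ ^ 2 * ‖ξ‖ ^ (-2 - b) := by gcongr
        _ = ‖ξ‖ ^ (-b) := by
          rw [← Real.rpow_two, ← Real.rpow_add hn]
          congr 1
          ring
    · gcongr
      linarith [Real.neg_one_le_cos (inner ℝ (1 : ℂ) ξ)]
  refine ((lintegral_mono hle).trans_lt ?_).ne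
  exact hint.lintegral_lt_top

/-- The mutual energy of two measures for the kernel `‖x - y‖ ^ b`. -/
def mutualEnergy (b : ℝ) (μ ν : Measure ℂ) : ℝ≥0∞ :=
  ∫⁻ x, ∫⁻ y, ENNReal.ofReal (‖x - y‖ ^ b) ∂ν ∂μ

/-- The addition formula for the cosine separates the variables. Nonnegativity is recorded because
`ENNReal.ofReal` would otherwise truncate. -/
theorem lintegral_lintegral_one_sub_cos (μ ν : Measure ℂ) [IsProbabilityMeasure μ]
    [IsProbabilityMeasure ν] (ξ : ℂ) :
    ∫⁻ x, ∫⁻ y, ENNReal.ofReal (1 - Real.cos (inner ℝ (x - y) ξ)) ∂ν ∂μ =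
      ENNReal.ofReal (1 -
        (∫ x, Real.cos (inner ℝ x ξ) ∂μ) * (∫ y, Real.cos (inner ℝ y ξ) ∂ν) -
        (∫ x, Real.sin (inner ℝ x ξ) ∂μ) * ∫ y, Real.sin (inner ℝ y ξ) ∂ν) ∧
    0 ≤ 1 - (∫ x, Real.cos (inner ℝ x ξ) ∂μ) * (∫ y, Real.cos (inner ℝ y ξ) ∂ν) -
        (∫ x, Real.sin (inner ℝ x ξ) ∂μ) * ∫ y, Real.sin (inner ℝ y ξ) ∂ν := by
  have hcos : ∀ (κ : Measure ℂ) [IsProbabilityMeasure κ],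
      Integrable (fun x => Real.cos (inner ℝ x ξ)) κ := fun κ _ =>
    Integrable.of_bound (by fun_prop) 1
      (Filter.Eventually.of_forall fun x => by simpa using Real.abs_cos_le_one _)
  have hsin : ∀ (κ : Measure ℂ) [IsProbabilityMeasure κ],
      Integrable (fun x => Real.sin (inner ℝ x ξ)) κ := fun κ _ =>
    Integrable.of_bound (by fun_prop) 1
      (Filter.Eventually.of_forall fun x => by simpa using Real.abs_sin_le_one _)
  have h1 : ∀ x : ℂ, ∫⁻ y, ENNReal.ofReal (1 - Real.cos (inner ℝ (x - y) ξ)) ∂ν =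
      ENNReal.ofReal (1 - Real.cos (inner ℝ x ξ) * (∫ y, Real.cos (inner ℝ y ξ) ∂ν) -
        Real.sin (inner ℝ x ξ) * ∫ y, Real.sin (inner ℝ y ξ) ∂ν) ∧
      0 ≤ 1 - Real.cos (inner ℝ x ξ) * (∫ y, Real.cos (inner ℝ y ξ) ∂ν) -
        Real.sin (inner ℝ x ξ) * ∫ y, Real.sin (inner ℝ y ξ) ∂ν := by
    intro x
    have hi1 : Integrable (fun y => 1 - Real.cos (inner ℝ x ξ) * Real.cos (inner ℝ y ξ)) ν :=
      (integrable_const 1).sub ((hcos ν).const_mul _)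
    have hi2 : Integrable (fun y => Real.sin (inner ℝ x ξ) * Real.sin (inner ℝ y ξ)) ν :=
      (hsin ν).const_mul _
    have he : ∀ y : ℂ, 1 - Real.cos (inner ℝ (x - y) ξ) =
        1 - Real.cos (inner ℝ x ξ) * Real.cos (inner ℝ y ξ) -
          Real.sin (inner ℝ x ξ) * Real.sin (inner ℝ y ξ) := fun y => by
      rw [inner_sub_left, Real.cos_sub]
      ring
    have hnn : ∀ y : ℂ, 0 ≤ 1 - Real.cos (inner ℝ x ξ) * Real.cos (inner ℝ y ξ) -
          Real.sin (inner ℝ x ξ) * Real.sin (inner ℝ y ξ) := fun y => by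
      rw [← he y]
      linarith [Real.cos_le_one (inner ℝ (x - y) ξ)]
    have hval : ∫ y, (1 - Real.cos (inner ℝ x ξ) * Real.cos (inner ℝ y ξ) -
          Real.sin (inner ℝ x ξ) * Real.sin (inner ℝ y ξ)) ∂ν =
        1 - Real.cos (inner ℝ x ξ) * (∫ y, Real.cos (inner ℝ y ξ) ∂ν) -
        Real.sin (inner ℝ x ξ) * ∫ y, Real.sin (inner ℝ y ξ) ∂ν := by
      rw [integral_sub hi1 hi2, integral_sub (integrable_const 1) ((hcos ν).const_mul _),
        integral_const_mul, integral_const_mul]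
      simp
    refine ⟨?_, hval ▸ integral_nonneg hnn⟩
    simp only [he]
    rw [← hval]
    exact (ofReal_integral_eq_lintegral_ofReal (hi1.sub hi2)
      (Filter.Eventually.of_forall hnn)).symm
  have hj1 : Integrable (fun x => 1 - Real.cos (inner ℝ x ξ) *
      (∫ y, Real.cos (inner ℝ y ξ) ∂ν)) μ := (integrable_const 1).sub ((hcos μ).mul_const _)
  have hj2 : Integrable (fun x => Real.sin (inner ℝ x ξ) * ∫ y, Real.sin (inner ℝ y ξ) ∂ν) μ :=
    (hsin μ).mul_const _
  have hval : ∫ x, (1 - Real.cos (inner ℝ x ξ) * (∫ y, Real.cos (inner ℝ y ξ) ∂ν) -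
        Real.sin (inner ℝ x ξ) * ∫ y, Real.sin (inner ℝ y ξ) ∂ν) ∂μ =
      1 - (∫ x, Real.cos (inner ℝ x ξ) ∂μ) * (∫ y, Real.cos (inner ℝ y ξ) ∂ν) -
        (∫ x, Real.sin (inner ℝ x ξ) ∂μ) * ∫ y, Real.sin (inner ℝ y ξ) ∂ν := by
    rw [integral_sub hj1 hj2, integral_sub (integrable_const 1) ((hcos μ).mul_const _),
      integral_mul_const, integral_mul_const]
    simp
  refine ⟨?_, hval ▸ integral_nonneg fun x => (h1 x).2⟩
  rw [lintegral_congr fun x => (h1 x).1, ← hval]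
  exact (ofReal_integral_eq_lintegral_ofReal (hj1.sub hj2)
    (Filter.Eventually.of_forall fun x => (h1 x).2)).symm

theorem mutualEnergy_mul_eq {b : ℝ} (hb : 0 < b) (μ ν : Measure ℂ) [IsProbabilityMeasure μ]
    [IsProbabilityMeasure ν] :
    mutualEnergy b μ ν * ∫⁻ ξ, cosKernel b 1 ξ =
      ∫⁻ ξ : ℂ, ENNReal.ofReal (1 -
        (∫ x, Real.cos (inner ℝ x ξ) ∂μ) * (∫ y, Real.cos (inner ℝ y ξ) ∂ν) -
        (∫ x, Real.sin (inner ℝ x ξ) ∂μ) * ∫ y, Real.sin (inner ℝ y ξ) ∂ν) *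
        ENNReal.ofReal (‖ξ‖ ^ (-2 - b)) := by
  have hmx : Measurable fun x : ℂ => ∫⁻ y, ENNReal.ofReal (‖x - y‖ ^ b) ∂ν :=
    Measurable.lintegral_prod_right' (f := fun p : ℂ × ℂ => ENNReal.ofReal (‖p.1 - p.2‖ ^ b))
      (by fun_prop)
  calc mutualEnergy b μ ν * ∫⁻ ξ, cosKernel b 1 ξ
      = ∫⁻ x, ∫⁻ y, ∫⁻ ξ, cosKernel b (x - y) ξ ∂volume ∂ν ∂μ := by
        unfold mutualEnergy
        rw [← lintegral_mul_const _ hmx]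
        refine lintegral_congr fun x => ?_
        rw [← lintegral_mul_const _ (by fun_prop)]
        exact lintegral_congr fun y => (lintegral_cosKernel hb (x - y)).symm
    _ = ∫⁻ x, ∫⁻ ξ, ∫⁻ y, cosKernel b (x - y) ξ ∂ν ∂volume ∂μ := by
        refine lintegral_congr fun x => lintegral_lintegral_swap ?_
        unfold cosKernel
        fun_prop
    _ = ∫⁻ ξ, ∫⁻ x, ∫⁻ y, cosKernel b (x - y) ξ ∂ν ∂μ := by
        refine lintegral_lintegral_swap (Measurable.aemeasurable ?_)
        exact Measurable.lintegral_prod_right' (f := fun p : (ℂ × ℂ) × ℂ =>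
          cosKernel b (p.1.1 - p.2) p.1.2) (by unfold cosKernel; fun_prop)
    _ = _ := by
        refine lintegral_congr fun ξ => ?_
        rw [← (lintegral_lintegral_one_sub_cos μ ν ξ).1]
        unfold cosKernel
        rw [← lintegral_mul_const]
        · exact lintegral_congr fun x => lintegral_mul_const _ (by fun_prop)
        · exact Measurable.lintegral_prod_right' (f := fun p : ℂ × ℂ =>
            ENNReal.ofReal (1 - Real.cos (inner ℝ (p.1 - p.2) ξ))) (by fun_prop)

/-- The kernel `‖x - y‖ ^ b` is conditionally negative definite for `0 < b < 2`. -/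
theorem mutualEnergy_add_le {b : ℝ} (hb : 0 < b) (hb2 : b < 2) (μ ν : Measure ℂ)
    [IsProbabilityMeasure μ] [IsProbabilityMeasure ν] :
    mutualEnergy b μ μ + mutualEnergy b ν ν ≤ 2 * mutualEnergy b μ ν := by
  refine (ENNReal.mul_le_mul_iff_left (lintegral_cosKernel_one_ne_zero b)
    (lintegral_cosKernel_one_ne_top hb hb2)).1 ?_
  rw [add_mul, mul_assoc, mutualEnergy_mul_eq hb, mutualEnergy_mul_eq hb, mutualEnergy_mul_eq hb]
  have hsm : ∀ (κ : Measure ℂ) [IsProbabilityMeasure κ],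
      Measurable (fun ξ : ℂ => ∫ x, Real.cos (inner ℝ x ξ) ∂κ) ∧
      Measurable (fun ξ : ℂ => ∫ x, Real.sin (inner ℝ x ξ) ∂κ) := fun κ _ =>
    ⟨(StronglyMeasurable.integral_prod_right' (f := fun p : ℂ × ℂ => Real.cos (inner ℝ p.2 p.1))
      (by fun_prop : Continuous _).stronglyMeasurable).measurable,
    (StronglyMeasurable.integral_prod_right' (f := fun p : ℂ × ℂ => Real.sin (inner ℝ p.2 p.1))
      (by fun_prop : Continuous _).stronglyMeasurable).measurable⟩
  obtain ⟨hμc, hμs⟩ := hsm μ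
  obtain ⟨hνc, hνs⟩ := hsm ν
  have hnn : ∀ (κ : Measure ℂ) [IsProbabilityMeasure κ] (ξ : ℂ), 0 ≤ 1 -
        (∫ x, Real.cos (inner ℝ x ξ) ∂κ) * (∫ y, Real.cos (inner ℝ y ξ) ∂κ) -
        (∫ x, Real.sin (inner ℝ x ξ) ∂κ) * ∫ y, Real.sin (inner ℝ y ξ) ∂κ := fun κ _ ξ =>
    (lintegral_lintegral_one_sub_cos κ κ ξ).2
  rw [← lintegral_add_left (by fun_prop), ← lintegral_const_mul _ (by fun_prop)]
  refine lintegral_mono fun ξ => ?_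
  rw [← add_mul, ← mul_assoc]
  gcongr
  rw [← ENNReal.ofReal_add (hnn μ ξ) (hnn ν ξ), ← ENNReal.ofReal_ofNat 2,
    ← ENNReal.ofReal_mul (by norm_num)]
  refine ENNReal.ofReal_le_ofReal ?_
  -- Right side minus left side is the squared modulus of the difference of the Fourier transforms
  -- of μ and ν at ξ.
  nlinarith [sq_nonneg ((∫ x, Real.cos (inner ℝ x ξ) ∂μ) - ∫ x, Real.cos (inner ℝ x ξ) ∂ν),
    sq_nonneg ((∫ x, Real.sin (inner ℝ x ξ) ∂μ) - ∫ x, Real.sin (inner ℝ x ξ) ∂ν)]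

/-- Among the probability measures on the closed unit disk the uniform measure on the circle
maximizes the energy for the kernel `‖x - y‖ ^ b`, `0 < b < 2`. -/
theorem mutualEnergy_self_le {b : ℝ} (hb : 0 < b) (hb2 : b < 2) (μ : Measure ℂ)
    [IsProbabilityMeasure μ] (hμ : ∀ᵐ x ∂μ, ‖x‖ ≤ 1) :
    mutualEnergy b μ μ ≤ ENNReal.ofReal (circleMean b) := by
  have h1 := mutualEnergy_add_le hb hb2 μ circleMeasure
  have h2 : mutualEnergy b μ circleMeasure ≤ ENNReal.ofReal (circleMean b) := by
    refine (lintegral_mono_ae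
      (hμ.mono fun x hx => lintegral_norm_sub_circleMeasure_le hb hx)).trans ?_
    simp
  have h3 : mutualEnergy b circleMeasure circleMeasure = ENNReal.ofReal (circleMean b) :=
    lintegral_lintegral_circleMeasure hb
  rw [h3] at h1
  have h4 := h1.trans (mul_le_mul_right h2 2)
  rw [two_mul] at h4
  exact (ENNReal.add_le_add_iff_right ENNReal.ofReal_ne_top).1 h4

/-! ### Energies of disks, pairs and regular triples -/

theorem rieszEnergy_neg {E : Type*} [MeasurableSpace E] [PseudoEMetricSpace E] {a : ℝ}
    (ha : 0 < a) (K : Set E) :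
    rieszEnergy (-a) K = ⨆ μ ∈ probOn K, ∫⁻ x, ∫⁻ y, edist x y ^ a ∂μ ∂μ := by
  simp only [rieszEnergy, if_neg (show ¬ 0 < -a by linarith), rieszEnergyOf, neg_neg]

theorem cap_neg {E : Type*} [MeasurableSpace E] [PseudoEMetricSpace E] {a : ℝ}
    (ha : 0 < a) (K : Set E) : cap (-a) K = rieszEnergy (-a) K ^ (1 / a) := by
  rw [cap, if_neg (by linarith), neg_div_neg_eq]

theorem edist_rpow_eq {E : Type*} [PseudoMetricSpace E] {a : ℝ} (ha : 0 < a) (x y : E) :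
    edist x y ^ a = ENNReal.ofReal (dist x y ^ a) := by
  rw [edist_dist, ENNReal.ofReal_rpow_of_nonneg dist_nonneg ha.le]

theorem rieszEnergy_closedBall_le {b : ℝ} (hb : 0 < b) (hb2 : b < 2)
    (c : EuclideanSpace ℝ (Fin 2)) {r : ℝ} (hr : 0 < r) :
    rieszEnergy (-b) (Metric.closedBall c r) ≤ ENNReal.ofReal (r ^ b * circleMean b) := by
  rw [rieszEnergy_neg hb]
  refine iSup₂_le fun μ hμ => ?_
  obtain ⟨hμ1, hμ2⟩ := hμ
  -- The similarity onto the unit disk of ℂ; it scales the energy by the factor r^b.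
  set φ : EuclideanSpace ℝ (Fin 2) → ℂ :=
    fun x => r⁻¹ • Complex.orthonormalBasisOneI.repr.symm (x - c) with hφ
  have hφm : Measurable φ := by
    have : Continuous φ := by fun_prop
    exact this.measurable
  have hdist : ∀ x y, dist x y = r * ‖φ x - φ y‖ := by
    intro x y
    simp only [hφ]
    rw [← smul_sub, ← map_sub, norm_smul, LinearIsometryEquiv.norm_map, sub_sub_sub_cancel_right,
      norm_inv, Real.norm_of_nonneg hr.le, mul_inv_cancel_left₀ hr.ne', dist_eq_norm]
  have hprob : IsProbabilityMeasure (μ.map φ) := Measure.isProbabilityMeasure_map hφm.aemeasurable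
  have hball : ∀ᵐ z ∂(μ.map φ), ‖z‖ ≤ 1 := by
    rw [ae_map_iff hφm.aemeasurable (measurableSet_le (by fun_prop) (by fun_prop))]
    have hae : ∀ᵐ x ∂μ, x ∈ Metric.closedBall c r := mem_ae_iff.2 hμ2
    filter_upwards [hae] with x hx
    rw [mem_closedBall_iff_norm] at hx
    simp only [hφ]
    rw [norm_smul, LinearIsometryEquiv.norm_map, norm_inv, Real.norm_of_nonneg hr.le,
      inv_mul_le_iff₀ hr, mul_one]
    exact hx
  have hin : Measurable fun z : ℂ => ∫⁻ w, ENNReal.ofReal (‖z - w‖ ^ b) ∂(μ.map φ) :=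
    Measurable.lintegral_prod_right' (f := fun p : ℂ × ℂ => ENNReal.ofReal (‖p.1 - p.2‖ ^ b))
      (by fun_prop)
  have hmut : mutualEnergy b (μ.map φ) (μ.map φ) =
      ∫⁻ x, ∫⁻ y, ENNReal.ofReal (‖φ x - φ y‖ ^ b) ∂μ ∂μ := by
    unfold mutualEnergy
    rw [lintegral_map hin hφm]
    exact lintegral_congr fun x => lintegral_map (by fun_prop) hφm
  have hen : ∫⁻ x, ∫⁻ y, edist x y ^ b ∂μ ∂μ =
      ENNReal.ofReal (r ^ b) * mutualEnergy b (μ.map φ) (μ.map φ) := by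
    have hrb : ENNReal.ofReal (r ^ b) ≠ ∞ := ENNReal.ofReal_ne_top
    rw [hmut, ← lintegral_const_mul' _ _ hrb]
    refine lintegral_congr fun x => ?_
    rw [← lintegral_const_mul' _ _ hrb]
    refine lintegral_congr fun y => ?_
    rw [edist_rpow_eq hb, hdist, Real.mul_rpow hr.le (norm_nonneg _),
      ENNReal.ofReal_mul (by positivity)]
  rw [hen, ENNReal.ofReal_mul (by positivity)]
  gcongr
  exact mutualEnergy_self_le hb hb2 _ hball

section

variable {E : Type*} [MeasurableSpace E] [MetricSpace E] [BorelSpace E]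

/-- The competitor is half a unit mass at each of the two points; only the two off-diagonal terms,
each of weight 1/4, contribute. -/
theorem le_rieszEnergy_of_mem {a : ℝ} (ha : 0 < a) {K : Set E} {x y : E}
    (hK : MeasurableSet K) (hx : x ∈ K) (hy : y ∈ K) :
    ENNReal.ofReal (dist x y ^ a / 2) ≤ rieszEnergy (-a) K := by
  rw [rieszEnergy_neg ha]
  set μ : Measure E := (2⁻¹ : ℝ≥0∞) • (Measure.dirac x + Measure.dirac y) with hμ
  have h2 : (2⁻¹ : ℝ≥0∞) + 2⁻¹ = 1 := ENNReal.inv_two_add_inv_two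
  have hmem : μ ∈ probOn K := by
    refine ⟨⟨?_⟩, ?_⟩
    · simp only [hμ, Measure.smul_apply, Measure.add_apply, measure_univ, smul_eq_mul, mul_add,
        mul_one, h2]
    · simp [hμ, hK, hx, hy]
  refine le_trans (le_of_eq ?_) (le_iSup₂ (f := fun μ (_ : μ ∈ probOn K) =>
    ∫⁻ x, ∫⁻ y, edist x y ^ a ∂μ ∂μ) μ hmem)
  simp only [hμ, lintegral_smul_measure, lintegral_add_measure, lintegral_dirac, smul_eq_mul,
    edist_self, ENNReal.zero_rpow_of_pos ha, zero_add, add_zero]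
  rw [edist_comm y x, ← two_mul, ← mul_assoc 2⁻¹ 2, ENNReal.inv_mul_cancel two_ne_zero
    ENNReal.ofNat_ne_top, one_mul, edist_rpow_eq ha, div_eq_inv_mul,
    ENNReal.ofReal_mul (by norm_num), ENNReal.ofReal_inv_of_pos two_pos, ENNReal.ofReal_ofNat]

theorem two_mul_sum_mul_le {m : Fin 3 → NNReal} (h : ∑ i, m i = 1) :
    2 * (m 0 * m 1 + m 0 * m 2 + m 1 * m 2) ≤ 2 / 3 := by
  have h' : (m 0 : ℝ) + m 1 + m 2 = 1 := by
    rw [Fin.sum_univ_three] at h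
    exact_mod_cast h
  rw [← NNReal.coe_le_coe]
  push_cast
  nlinarith [sq_nonneg ((m 0 : ℝ) - m 1), sq_nonneg ((m 0 : ℝ) - m 2),
    sq_nonneg ((m 1 : ℝ) - m 2), congrArg (fun t : ℝ => t ^ 2) h']

/-- The energy of three points with equal mutual distances. -/
theorem rieszEnergy_range_of_dist_eq {a s : ℝ} (ha : 0 < a) (hs : 0 < s) {f : Fin 3 → E}
    (hf : ∀ i j, i ≠ j → dist (f i) (f j) = s) :
    rieszEnergy (-a) (Set.range f) = ENNReal.ofReal (2 / 3 * s ^ a) := by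
  have hinj : Function.Injective f := fun i j hij => by
    by_contra hne
    have := hf i j hne
    rw [hij, dist_self] at this
    exact hs.ne this
  set K : NNReal := (s ^ a).toNNReal with hK
  have hK' : ((2 / 3 : NNReal) * K : NNReal) = ENNReal.ofReal (2 / 3 * s ^ a) := by
    rw [ENNReal.ofReal, Real.toNNReal_mul (by norm_num), hK]
    congr 2
    rw [Real.toNNReal_div (by norm_num)]
    simp
  have hed : ∀ i j, i ≠ j → edist (f i) (f j) ^ a = K := fun i j hij => by
    rw [edist_rpow_eq ha, hf i j hij]
    rfl
  have hself : ∀ i, edist (f i) (f i) ^ a = 0 := fun i => by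
    rw [edist_self, ENNReal.zero_rpow_of_pos ha]
  -- On three equidistant points the energy is a quadratic form in the masses, maximized at equal
  -- weights 1/3 whatever the exponent.
  have hval : ∀ μ : Measure E, μ (Set.range f)ᶜ = 0 → IsProbabilityMeasure μ →
      ∃ m : Fin 3 → NNReal, (∀ i, (m i : ℝ≥0∞) = μ {f i}) ∧ ∑ i, m i = 1 ∧
        ∫⁻ x, ∫⁻ y, edist x y ^ a ∂μ ∂μ =
          ((2 * (m 0 * m 1 + m 0 * m 2 + m 1 * m 2) * K : NNReal) : ℝ≥0∞) := by
    intro μ hμ hprob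
    have hsum : ∀ g : E → ℝ≥0∞, ∫⁻ x, g x ∂μ = ∑ i, g (f i) * μ {f i} := by
      intro g
      have hr : μ.restrict ((Finset.univ.map ⟨f, hinj⟩ : Finset E) : Set E) = μ := by
        refine Measure.restrict_eq_self_of_ae_mem (mem_ae_iff.2 ?_)
        rw [Finset.coe_map, Finset.coe_univ, Set.image_univ]
        exact hμ
      calc ∫⁻ x, g x ∂μ = ∫⁻ x in ((Finset.univ.map ⟨f, hinj⟩ : Finset E) : Set E), g x ∂μ := by
            rw [hr]
        _ = _ := by
            rw [lintegral_finset, Finset.sum_map]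
            rfl
    refine ⟨fun i => (μ {f i}).toNNReal, fun i => ENNReal.coe_toNNReal (measure_ne_top _ _), ?_, ?_⟩
    · have h1 := hsum 1
      simp only [Pi.one_apply, lintegral_const, measure_univ, one_mul] at h1
      rw [← ENNReal.coe_inj]
      push_cast
      rw [h1]
      exact Finset.sum_congr rfl fun i _ => ENNReal.coe_toNNReal (measure_ne_top _ _)
    · have hm : ∀ i, μ {f i} = ((μ {f i}).toNNReal : ℝ≥0∞) := fun i =>
        (ENNReal.coe_toNNReal (measure_ne_top _ _)).symm
      simp only [hsum, Fin.sum_univ_three, hself, hed 0 1 (by decide), hed 0 2 (by decide),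
        hed 1 0 (by decide), hed 1 2 (by decide), hed 2 0 (by decide), hed 2 1 (by decide)]
      rw [hm 0, hm 1, hm 2]
      norm_cast
      ring
  rw [rieszEnergy_neg ha, ← hK']
  refine le_antisymm (iSup₂_le fun μ hμ => ?_) ?_
  · obtain ⟨m, -, hm1, hm2⟩ := hval μ hμ.2 hμ.1
    rw [hm2, ENNReal.coe_le_coe]
    gcongr
    exact two_mul_sum_mul_le hm1
  · set μ : Measure E := (3⁻¹ : ℝ≥0∞) • ∑ i, Measure.dirac (f i) with hμ
    have hmeas : MeasurableSet (Set.range f) := (Set.finite_range f).measurableSet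
    have hmem : μ ∈ probOn (Set.range f) := by
      refine ⟨⟨?_⟩, ?_⟩
      · simp [hμ, ENNReal.inv_mul_cancel]
      · simp [hμ, hmeas]
    refine le_trans (le_of_eq ?_) (le_iSup₂ (f := fun μ (_ : μ ∈ probOn (Set.range f)) =>
      ∫⁻ x, ∫⁻ y, edist x y ^ a ∂μ ∂μ) μ hmem)
    obtain ⟨m, hm, -, hm2⟩ := hval μ hmem.2 hmem.1
    have hm3 : ∀ i, m i = 3⁻¹ := fun i => by
      have hi : μ {f i} = 3⁻¹ := by
        have h1 : ∀ j, ({f i} : Set E).indicator (1 : E → ℝ≥0∞) (f j) = if j = i then 1 else 0 :=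
          fun j => by
            split_ifs with h
            · simp [h]
            · simp [hinj.eq_iff, h]
        simp [hμ, h1]
      rw [← ENNReal.coe_inj, hm i, hi]
      simp
    rw [hm2, hm3, hm3, hm3]
    congr 2
    rw [← NNReal.coe_inj]
    push_cast
    norm_num

end

/-! ### Comparison of the capacity ratios -/

theorem capRatio_closedBall_lt {a b s r : ℝ} (ha : 0 < a) (hb : 0 < b) (hb2 : b < 2)
    (hab : b * Real.log (4 / 3) < a * Real.log (gammaQuotient b)) (hs : 0 < s) (hr : 0 < r)
    (c : EuclideanSpace ℝ (Fin 2)) {f : Fin 3 → EuclideanSpace ℝ (Fin 2)}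
    (hf : ∀ i j, i ≠ j → dist (f i) (f j) = s) :
    capRatio (-b) (-a) (Metric.closedBall c r) < capRatio (-b) (-a) (Set.range f) := by
  have hW := circleMean_pos hb
  have hR := gammaQuotient_pos hb
  set X : ℝ := (r ^ b * circleMean b) ^ (1 / b) with hX
  set Y : ℝ := ((2 * r) ^ a / 2) ^ (1 / a) with hY
  set Z : ℝ := (2 / 3 * s ^ b) ^ (1 / b) with hZ
  set T : ℝ := (2 / 3 * s ^ a) ^ (1 / a) with hT
  have hX0 : 0 < X := by positivity
  have hY0 : 0 < Y := by positivity
  have hZ0 : 0 < Z := by positivity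
  have hT0 : 0 < T := by positivity
  have hle : capRatio (-b) (-a) (Metric.closedBall c r) ≤ ENNReal.ofReal (X / Y) := by
    rw [capRatio, cap_neg hb, cap_neg ha, ENNReal.ofReal_div_of_pos hY0, hX, hY,
      ← ENNReal.ofReal_rpow_of_nonneg (by positivity) (by positivity),
      ← ENNReal.ofReal_rpow_of_nonneg (by positivity) (by positivity)]
    refine ENNReal.div_le_div (ENNReal.rpow_le_rpow (rieszEnergy_closedBall_le hb hb2 c hr)
      (by positivity)) (ENNReal.rpow_le_rpow ?_ (by positivity))
    -- The points c ± v are the ends of a diameter, at distance 2r.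
    set v : EuclideanSpace ℝ (Fin 2) := EuclideanSpace.single 0 r with hv
    have hvn : ‖v‖ = r := by simp [hv, abs_of_pos hr]
    have hd : dist (c + v) (c - v) = 2 * r := by
      rw [dist_eq_norm, show c + v - (c - v) = (2 : ℝ) • v by rw [two_smul]; abel, norm_smul, hvn]
      norm_num
    rw [← hd]
    refine le_rieszEnergy_of_mem ha Metric.isClosed_closedBall.measurableSet ?_ ?_
    · simp [hvn]
    · simp [hvn]
  have heq : capRatio (-b) (-a) (Set.range f) = ENNReal.ofReal (Z / T) := by
    rw [capRatio, cap_neg hb, cap_neg ha, ENNReal.ofReal_div_of_pos hT0, hZ, hT,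
      ← ENNReal.ofReal_rpow_of_nonneg (by positivity) (by positivity),
      ← ENNReal.ofReal_rpow_of_nonneg (by positivity) (by positivity),
      rieszEnergy_range_of_dist_eq hb hs hf, rieszEnergy_range_of_dist_eq ha hs hf]
  rw [heq]
  refine hle.trans_lt ((ENNReal.ofReal_lt_ofReal_iff (by positivity)).2 ?_)
  rw [← Real.log_lt_log_iff (by positivity) (by positivity), Real.log_div hX0.ne' hY0.ne',
    Real.log_div hZ0.ne' hT0.ne', hX, hY, hZ, hT, Real.log_rpow (by positivity),
    Real.log_rpow (by positivity), Real.log_rpow (by positivity), Real.log_rpow (by positivity),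
    Real.log_mul (by positivity) hW.ne', Real.log_div (by positivity) (by positivity),
    Real.log_mul (by positivity) (by positivity), Real.log_mul (by positivity) (by positivity),
    Real.log_rpow hr, Real.log_rpow (by positivity), Real.log_rpow hs, Real.log_rpow hs,
    Real.log_mul two_ne_zero hr.ne']
  have h1 : Real.log (circleMean b) + Real.log (gammaQuotient b) =
      b * Real.log 2 + Real.log (2 / 3) := by
    rw [← Real.log_mul hW.ne' hR.ne', circleMean_mul_gammaQuotient hb,
      Real.log_mul (by positivity) (by positivity), Real.log_rpow two_pos]
  have h2 : Real.log (4 / 3) = Real.log 2 + Real.log (2 / 3) := by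
    rw [← Real.log_mul (by norm_num) (by norm_num)]
    norm_num
  -- After taking logarithms the terms in r, s and (1/b) log(2/3) cancel, and this inequality is all
  -- that remains.
  have h3 : 1 / a * Real.log (4 / 3) < 1 / b * Real.log (gammaQuotient b) := by
    rw [one_div_mul_eq_div, one_div_mul_eq_div, div_lt_div_iff₀ ha hb]
    linarith
  have hb1 : 1 / b * b = 1 := one_div_mul_cancel hb.ne'
  have ha1 : 1 / a * a = 1 := one_div_mul_cancel ha.ne'
  rw [eq_sub_of_add_eq h1]
  rw [h2] at h3
  have e1 : 1 / b * (b * Real.log r + (b * Real.log 2 + Real.log (2 / 3) -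
      Real.log (gammaQuotient b))) = Real.log r + Real.log 2 + 1 / b * Real.log (2 / 3) -
      1 / b * Real.log (gammaQuotient b) := by
    linear_combination (Real.log r + Real.log 2) * hb1
  have e2 : 1 / a * (a * (Real.log 2 + Real.log r) - Real.log 2) =
      Real.log 2 + Real.log r - 1 / a * Real.log 2 := by
    linear_combination (Real.log 2 + Real.log r) * ha1
  have e3 : 1 / b * (Real.log (2 / 3) + b * Real.log s) =
      1 / b * Real.log (2 / 3) + Real.log s := by
    linear_combination Real.log s * hb1
  have e4 : 1 / a * (Real.log (2 / 3) + a * Real.log s) =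
      1 / a * Real.log (2 / 3) + Real.log s := by
    linear_combination Real.log s * ha1
  rw [e1, e2, e3, e4]
  linarith

theorem exists_three_points_dist_eq_one :
    ∃ f : Fin 3 → EuclideanSpace ℝ (Fin 2), ∀ i j, i ≠ j → dist (f i) (f j) = 1 := by
  have h3 : (√3 : ℝ) ^ 2 = 3 := Real.sq_sqrt (by norm_num)
  have h1 : dist (!₂[0, 0] : EuclideanSpace ℝ (Fin 2)) !₂[1, 0] = 1 := by
    simp [EuclideanSpace.dist_eq, Real.dist_eq]
  have h2 : dist (!₂[0, 0] : EuclideanSpace ℝ (Fin 2)) !₂[1 / 2, √3 / 2] = 1 := by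
    simp only [EuclideanSpace.dist_eq, Real.dist_eq, Fin.sum_univ_two, sq_abs, Real.sqrt_eq_one]
    simp [div_pow, h3]
    norm_num
  have h4 : dist (!₂[1, 0] : EuclideanSpace ℝ (Fin 2)) !₂[1 / 2, √3 / 2] = 1 := by
    simp only [EuclideanSpace.dist_eq, Real.dist_eq, Fin.sum_univ_two, sq_abs, Real.sqrt_eq_one]
    simp [div_pow, h3]
    norm_num
  refine ⟨![!₂[0, 0], !₂[1, 0], !₂[1 / 2, √3 / 2]], fun i j hij => ?_⟩
  fin_cases i <;> fin_cases j <;> first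
    | exact absurd rfl hij
    | assumption
    | (rw [dist_comm]; assumption)

end RieszCapacity

end

open RieszCapacity in
theorem mainTheorem8 :
    ∃ qs : ℝ, qs < 0 ∧ |qs - (-0.856)| < 0.0005 ∧
      (∀ q : ℝ, q < 0 →
        (2 * √Real.pi * Real.Gamma (1 - q / 2) = 3 * Real.Gamma ((1 - q) / 2) ↔ q = qs)) ∧
      ∀ p q : ℝ, -2 < q → q < qs →
        p < q * Real.log (4 / 3) /
          Real.log (2 * √Real.pi * Real.Gamma (1 - q / 2) / (3 * Real.Gamma ((1 - q) / 2))) →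
        (∀ (c : EuclideanSpace ℝ (Fin 2)) (r : ℝ), 0 < r →
          ∀ S : Set (EuclideanSpace ℝ (Fin 2)), RieszCapacity.IsRegularThreePointSet S →
            RieszCapacity.capRatio q p (Metric.closedBall c r) <
              RieszCapacity.capRatio q p S) ∧
        (∀ (c : EuclideanSpace ℝ (Fin 2)) (r : ℝ), 0 < r →
          ¬ IsMaxOn (RieszCapacity.capRatio q p)
            {K : Set (EuclideanSpace ℝ (Fin 2)) | IsCompact K ∧ K.Nontrivial}
            (Metric.closedBall c r)) := by
  obtain ⟨b₀, hb₁, hb₂, hb₀⟩ := exists_gammaQuotient_eq_one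
  have hb0 : 0 < b₀ := by linarith
  have hquot : ∀ q : ℝ, 2 * √Real.pi * Real.Gamma (1 - q / 2) / (3 * Real.Gamma ((1 - q) / 2)) =
      gammaQuotient (-q) := fun q => by
    rw [gammaQuotient, neg_div, ← sub_eq_add_neg, ← sub_eq_add_neg]
  refine ⟨-b₀, by linarith, by rw [abs_lt]; constructor <;> linarith, fun q hq => ?_, ?_⟩
  · have hG : 0 < Real.Gamma ((1 - q) / 2) := Real.Gamma_pos_of_pos (by linarith)
    rw [← div_eq_one_iff_eq (by positivity), hquot]
    constructor
    · intro h
      rcases lt_trichotomy (-q) b₀ with hlt | heq | hgt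
      · have := gammaQuotient_lt (by linarith) hlt
        linarith
      · linarith
      · have := gammaQuotient_lt hb0 hgt
        linarith
    · rintro rfl
      rwa [neg_neg]
  intro p q hq2 hq hp
  rw [hquot] at hp
  obtain ⟨b, rfl⟩ : ∃ b, q = -b := ⟨-q, by ring⟩
  obtain ⟨a, rfl⟩ : ∃ a, p = -a := ⟨-p, by ring⟩
  rw [neg_neg] at hp
  have hb : 0 < b := by linarith
  have hlog : 0 < Real.log (gammaQuotient b) := by
    refine Real.log_pos ?_
    rw [← hb₀]
    exact gammaQuotient_lt hb0 (by linarith)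
  have hlog4 : 0 < Real.log (4 / 3) := Real.log_pos (by norm_num)
  rw [lt_div_iff₀ hlog] at hp
  have hab : b * Real.log (4 / 3) < a * Real.log (gammaQuotient b) := by linarith
  -- Negativity of p is not assumed: for q below q_* the logarithm in the denominator is positive,
  -- so the bound on p is itself negative.
  have ha : 0 < a := pos_of_mul_pos_left ((mul_pos hb hlog4).trans hab) hlog.le
  refine ⟨fun c r hr S hS => ?_, fun c r hr hmax => ?_⟩
  · obtain ⟨t, ⟨s, hs⟩, rfl⟩ := hS
    have hs0 : 0 < s := by
      rw [← hs 0 1 (by decide), dist_pos]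
      exact t.independent.injective.ne (by decide)
    exact capRatio_closedBall_lt ha hb (by linarith) hab hs0 hr c hs
  · obtain ⟨f, hf⟩ := exists_three_points_dist_eq_one
    have hlt := capRatio_closedBall_lt ha hb (by linarith) hab one_pos hr c hf
    refine hlt.not_ge (hmax ⟨(Set.finite_range f).isCompact, f 0, ⟨0, rfl⟩, f 1, ⟨1, rfl⟩, ?_⟩)
    rw [← dist_pos, hf 0 1 (by decide)]
    exact one_pos
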